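/- An adequate monoid is a monoid with two unary operations $x\mapsto x^+$ and $x\mapsto x^*$ satisfying, for all $x,y,z$, the conditions $x^+x=x$, $(x^+y^+)^+=x^+y^+=y^+x^+$, $(xy)^+=(xy^+)^+$, $x^2=x\Rightarrow x=x^+$, $xz=yz\Rightarrow xz^+=yz^+$, together with the dual conditions $xx^*=x$, $(x^*y^*)^*=x^*y^*=y^*x^*$, $(xy)^*=(x^*y)^*$, $x^2=x\Rightarrow x=x^*$, $zx=zy\Rightarrow z^*x=z^*y$. Let $\mathrm{FAd}(a)$ be the free adequate monoid on one generator $a$. The length of a word built from $a$ and the identity by multiplication, $^+$ and $^*$ is its number of occurrences of $a$. Let $S_E(n)$ be the set of idempotents of $\mathrm{FAd}(a)$ that can be written as a word of length $n$ but not as a shorter word. A word represents a finite tree with edges directed and labelled by $a$ and with two distinguished vertices, start and end: the identity represents a single vertex, $a$ a single edge from start to end; a product is formed by identifying the end vertex of the first tree with the start vertex of the second; $^+$ moves the end vertex to the start vertex, and $^*$ moves the start vertex to the end vertex. A tree is retract-free if its only idempotent endomorphism (preserving start and end) is the identity. An element of $\mathrm{FAd}(a)$ has $n$ edges if some word for it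 represents a retract-free tree with exactly $n$ edges. Theorem. Every $S_E(n)$, $n\ge 0$, is finite. For every $n\ge 1$, $$|S_E(n)|\ \ge\ \binom{n-1}{\lfloor (n-1)/2\rfloor},$$ and likewise the number of idempotents of $\mathrm{FAd}(a)$ with $n$ edges is finite and at least $\binom{n-1}{\lfloor (n-1)/2\rfloor}$. As $n\to\infty$, $$\binom{n-1}{\lfloor (n-1)/2\rfloor}\ \sim\ 2^{n-1}\sqrt{\frac{2}{(n-1)\pi}}.$$ Consequently the idempotent growth of $\mathrm{FAd}(a)$ is exponential of degree at least $2$: $$2\ \le\ \liminf_{n\to\infty}|S_E(n)|^{1/n}\ \le\ \limsup_{n\to\infty}|S_E(n)|^{1/n}\ <\ \infty .$$ -/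

import Mathlib

open Filter Topology Asymptotics
open scoped ENNReal

universe u v

/-- A (two-sided) adequate monoid, as an algebra of signature `(2,1,1,0)`: a monoid with unary
operations `plus` (written `x⁺` on paper) and `star` (written `x*`) satisfying the defining
quasi-identities of left adequate monoids for `plus` and of right adequate monoids for `star`. -/
class AdequateMonoid (M : Type v) extends Monoid M where
  plus : M → M
  star : M → M
  plus_mul_self : ∀ x : M, plus x * x = x
  plus_plus_mul_plus : ∀ x y : M, plus (plus x * plus y) = plus x * plus y
  plus_comm : ∀ x y : M, plus x * plus y = plus y * plus x
  plus_mul : ∀ x y : M, plus (x * y) = plus (x * plus y)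
  eq_plus_of_idem : ∀ x : M, x * x = x → x = plus x
  mul_plus_of_mul_eq : ∀ x y z : M, x * z = y * z → x * plus z = y * plus z
  mul_star_self : ∀ x : M, x * star x = x
  star_star_mul_star : ∀ x y : M, star (star x * star y) = star x * star y
  star_comm : ∀ x y : M, star x * star y = star y * star x
  star_mul : ∀ x y : M, star (x * y) = star (star x * y)
  eq_star_of_idem : ∀ x : M, x * x = x → x = star x
  star_mul_of_mul_eq : ∀ x y z : M, z * x = z * y → star z * x = star z * y

/-- Words in the signature `(2,1,1,0)` over the alphabet `X`. -/
inductive BiWord (X : Type u) : Type u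
  | one : BiWord X
  | of : X → BiWord X
  | mul : BiWord X → BiWord X → BiWord X
  | plus : BiWord X → BiWord X
  | star : BiWord X → BiWord X

namespace BiWord

/-- The length of a word: the number of occurrences of letters of `X`. It does not change
under the monoid laws, so it is the length of the element of the free biunary monoid. -/
def length {X : Type u} : BiWord X → ℕ
  | one => 0
  | of _ => 1
  | mul s t => s.length + t.length
  | plus s => s.length
  | star s => s.length

/-- The value of a word in an adequate monoid under an assignment of the letters. -/
def eval {X : Type u} {M : Type v} [AdequateMonoid M] (f : X → M) : BiWord X → M
  | one => 1
  | of x => f x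
  | mul s t => s.eval f * t.eval f
  | plus s => AdequateMonoid.plus (s.eval f)
  | star s => AdequateMonoid.star (s.eval f)

/-- The least congruence on words whose quotient is an adequate monoid. -/
inductive Rel {X : Type u} : BiWord X → BiWord X → Prop
  | refl (s : BiWord X) : Rel s s
  | symm {s t : BiWord X} : Rel s t → Rel t s
  | trans {r s t : BiWord X} : Rel r s → Rel s t → Rel r t
  | mul {s s' t t' : BiWord X} : Rel s s' → Rel t t' → Rel (s.mul t) (s'.mul t')
  | plus {s t : BiWord X} : Rel s t → Rel s.plus t.plus
  | star {s t : BiWord X} : Rel s t → Rel s.star t.star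
  | mul_assoc (r s t : BiWord X) : Rel ((r.mul s).mul t) (r.mul (s.mul t))
  | one_mul (s : BiWord X) : Rel (one.mul s) s
  | mul_one (s : BiWord X) : Rel (s.mul one) s
  | plus_mul_self (x : BiWord X) : Rel (x.plus.mul x) x
  | plus_plus_mul_plus (x y : BiWord X) : Rel (x.plus.mul y.plus).plus (x.plus.mul y.plus)
  | plus_comm (x y : BiWord X) : Rel (x.plus.mul y.plus) (y.plus.mul x.plus)
  | plus_mul (x y : BiWord X) : Rel (x.mul y).plus (x.mul y.plus).plus
  | eq_plus_of_idem {x : BiWord X} : Rel (x.mul x) x → Rel x x.plus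
  | mul_plus_of_mul_eq {x y z : BiWord X} : Rel (x.mul z) (y.mul z) → Rel (x.mul z.plus) (y.mul z.plus)
  | mul_star_self (x : BiWord X) : Rel (x.mul x.star) x
  | star_star_mul_star (x y : BiWord X) : Rel (x.star.mul y.star).star (x.star.mul y.star)
  | star_comm (x y : BiWord X) : Rel (x.star.mul y.star) (y.star.mul x.star)
  | star_mul (x y : BiWord X) : Rel (x.mul y).star (x.star.mul y).star
  | eq_star_of_idem {x : BiWord X} : Rel (x.mul x) x → Rel x x.star
  | star_mul_of_mul_eq {x y z : BiWord X} : Rel (z.mul x) (z.mul y) → Rel (z.star.mul x) (z.star.mul y)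

/-- The congruence `Rel` as a setoid. -/
def setoid (X : Type u) : Setoid (BiWord X) :=
  ⟨Rel, ⟨Rel.refl, Rel.symm, Rel.trans⟩⟩

end BiWord

/-- The free adequate monoid on the set `X`. -/
def FAd (X : Type u) : Type u := Quotient (BiWord.setoid X)

namespace FAd

/-- The canonical surjection from words onto the free adequate monoid. -/
def mk {X : Type u} (w : BiWord X) : FAd X := Quotient.mk (BiWord.setoid X) w

/-- The free generators. -/
def of {X : Type u} (x : X) : FAd X := mk (BiWord.of x)

instance instAdequateMonoid (X : Type u) : AdequateMonoid (FAd X) where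
  mul := Quotient.map₂ BiWord.mul (fun _ _ h _ _ k => BiWord.Rel.mul h k)
  one := mk BiWord.one
  plus := Quotient.map BiWord.plus (fun _ _ h => BiWord.Rel.plus h)
  star := Quotient.map BiWord.star (fun _ _ h => BiWord.Rel.star h)
  mul_assoc := by
    rintro ⟨r⟩ ⟨s⟩ ⟨t⟩; exact Quotient.sound (BiWord.Rel.mul_assoc r s t)
  one_mul := by rintro ⟨s⟩; exact Quotient.sound (BiWord.Rel.one_mul s)
  mul_one := by rintro ⟨s⟩; exact Quotient.sound (BiWord.Rel.mul_one s)
  plus_mul_self := by rintro ⟨x⟩; exact Quotient.sound (BiWord.Rel.plus_mul_self x)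
  plus_plus_mul_plus := by
    rintro ⟨x⟩ ⟨y⟩; exact Quotient.sound (BiWord.Rel.plus_plus_mul_plus x y)
  plus_comm := by rintro ⟨x⟩ ⟨y⟩; exact Quotient.sound (BiWord.Rel.plus_comm x y)
  plus_mul := by rintro ⟨x⟩ ⟨y⟩; exact Quotient.sound (BiWord.Rel.plus_mul x y)
  eq_plus_of_idem := by
    rintro ⟨x⟩ h; exact Quotient.sound (BiWord.Rel.eq_plus_of_idem (Quotient.exact h))
  mul_plus_of_mul_eq := by
    rintro ⟨x⟩ ⟨y⟩ ⟨z⟩ h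
    exact Quotient.sound (BiWord.Rel.mul_plus_of_mul_eq (Quotient.exact h))
  mul_star_self := by rintro ⟨x⟩; exact Quotient.sound (BiWord.Rel.mul_star_self x)
  star_star_mul_star := by
    rintro ⟨x⟩ ⟨y⟩; exact Quotient.sound (BiWord.Rel.star_star_mul_star x y)
  star_comm := by rintro ⟨x⟩ ⟨y⟩; exact Quotient.sound (BiWord.Rel.star_comm x y)
  star_mul := by rintro ⟨x⟩ ⟨y⟩; exact Quotient.sound (BiWord.Rel.star_mul x y)
  eq_star_of_idem := by
    rintro ⟨x⟩ h; exact Quotient.sound (BiWord.Rel.eq_star_of_idem (Quotient.exact h))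
  star_mul_of_mul_eq := by
    rintro ⟨x⟩ ⟨y⟩ ⟨z⟩ h
    exact Quotient.sound (BiWord.Rel.star_mul_of_mul_eq (Quotient.exact h))

/-- Words related by `Rel` have the same value in every adequate monoid. -/
theorem eval_eq_of_rel {X : Type u} {M : Type v} [AdequateMonoid M] (f : X → M)
    {s t : BiWord X} (h : BiWord.Rel s t) : s.eval f = t.eval f := by
  induction h with
  | refl s => rfl
  | symm _ ih => exact ih.symm
  | trans _ _ ih₁ ih₂ => exact ih₁.trans ih₂
  | mul _ _ ih₁ ih₂ => simp only [BiWord.eval, ih₁, ih₂]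
  | plus _ ih => simp only [BiWord.eval, ih]
  | star _ ih => simp only [BiWord.eval, ih]
  | mul_assoc r s t => exact _root_.mul_assoc _ _ _
  | one_mul s => exact _root_.one_mul _
  | mul_one s => exact _root_.mul_one _
  | plus_mul_self x => exact AdequateMonoid.plus_mul_self _
  | plus_plus_mul_plus x y => exact AdequateMonoid.plus_plus_mul_plus _ _
  | plus_comm x y => exact AdequateMonoid.plus_comm _ _
  | plus_mul x y => exact AdequateMonoid.plus_mul _ _
  | eq_plus_of_idem _ ih => exact AdequateMonoid.eq_plus_of_idem _ ih
  | mul_plus_of_mul_eq _ ih => exact AdequateMonoid.mul_plus_of_mul_eq _ _ _ ih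
  | mul_star_self x => exact AdequateMonoid.mul_star_self _
  | star_star_mul_star x y => exact AdequateMonoid.star_star_mul_star _ _
  | star_comm x y => exact AdequateMonoid.star_comm _ _
  | star_mul x y => exact AdequateMonoid.star_mul _ _
  | eq_star_of_idem _ ih => exact AdequateMonoid.eq_star_of_idem _ ih
  | star_mul_of_mul_eq _ ih => exact AdequateMonoid.star_mul_of_mul_eq _ _ _ ih

/-- The universal property: `FAd X` is freely generated by `X` among adequate monoids. -/
theorem existsUnique_hom {X : Type u} {M : Type v} [AdequateMonoid M] (f : X → M) :
    ∃! φ : FAd X →* M, (∀ m, φ (AdequateMonoid.plus m) = AdequateMonoid.plus (φ m)) ∧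
      (∀ m, φ (AdequateMonoid.star m) = AdequateMonoid.star (φ m)) ∧ ∀ x, φ (of x) = f x := by
  refine ⟨⟨⟨Quotient.lift (BiWord.eval f) (fun _ _ h => eval_eq_of_rel f h), rfl⟩, ?_⟩,
    ⟨?_, ?_, fun _ => rfl⟩, ?_⟩
  · rintro ⟨s⟩ ⟨t⟩; rfl
  · rintro ⟨s⟩; rfl
  · rintro ⟨s⟩; rfl
  · rintro ψ ⟨hp, hs, hx⟩
    refine MonoidHom.ext ?_
    rintro ⟨w⟩
    change ψ (mk w) = w.eval f
    induction w with
    | one => exact ψ.map_one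
    | of x => exact hx x
    | mul s t ih₁ ih₂ => exact (ψ.map_mul (mk s) (mk t)).trans (by rw [ih₁, ih₂]; rfl)
    | plus s ih => exact (hp (mk s)).trans (by rw [ih]; rfl)
    | star s ih => exact (hs (mk s)).trans (by rw [ih]; rfl)

/-- The ball of radius `n`: the elements represented by a word of length at most `n`. -/
def ball (X : Type u) (n : ℕ) : Set (FAd X) :=
  {m | ∃ w : BiWord X, w.length ≤ n ∧ mk w = m}

/-- The sphere `B(n) \ B(n-1)`, with `B(-1) = ∅`. -/
def sphere (X : Type u) (n : ℕ) : Set (FAd X) :=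
  {m | m ∈ ball X n ∧ ∀ k < n, m ∉ ball X k}

/-- The idempotents in the sphere of radius `n`. -/
def idempotentSphere (X : Type u) (n : ℕ) : Set (FAd X) :=
  {m | m ∈ sphere X n ∧ IsIdempotentElem m}

end FAd

/-- Directed graphs with edges labelled in `X` and two distinguished vertices, start and end. -/
structure XGraph (X : Type u) where
  V : Type
  E : Type
  src : E → V
  tgt : E → V
  label : E → X
  start : V
  finish : V

namespace XGraph

/-- Morphisms preserve incidence, labels, the start vertex and the end vertex. -/
structure Hom {X : Type u} (G H : XGraph X) where
  onV : G.V → H.V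
  onE : G.E → H.E
  src_eq : ∀ e, H.src (onE e) = onV (G.src e)
  tgt_eq : ∀ e, H.tgt (onE e) = onV (G.tgt e)
  label_eq : ∀ e, H.label (onE e) = G.label e
  start_eq : onV G.start = H.start
  finish_eq : onV G.finish = H.finish

/-- A retraction is an idempotent endomorphism. -/
def Hom.IsRetraction {X : Type u} {G : XGraph X} (ρ : Hom G G) : Prop :=
  (∀ v, ρ.onV (ρ.onV v) = ρ.onV v) ∧ ∀ e, ρ.onE (ρ.onE e) = ρ.onE e

/-- A graph is retract-free if its only retraction is the identity. -/
def RetractFree {X : Type u} (G : XGraph X) : Prop :=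
  ∀ ρ : Hom G G, ρ.IsRetraction → (∀ v, ρ.onV v = v) ∧ ∀ e, ρ.onE e = e

/-- The tree with one vertex and no edges. -/
def trivial (X : Type u) : XGraph X where
  V := Unit
  E := Empty
  src := Empty.elim
  tgt := Empty.elim
  label := Empty.elim
  start := ()
  finish := ()

/-- The tree with a single edge, labelled `x`, from the start vertex to the end vertex. -/
def edge {X : Type u} (x : X) : XGraph X where
  V := Bool
  E := Unit
  src := fun _ => false
  tgt := fun _ => true
  label := fun _ => x
  start := false
  finish := true

open Classical in
/-- The inclusion of the vertices of `T` in the vertices of the product of `S` and `T`, in which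
the start vertex of `T` is identified with the end vertex of `S`. -/
noncomputable def glueRight {X : Type u} (S T : XGraph X) (v : T.V) :
    S.V ⊕ {v : T.V // v ≠ T.start} :=
  if h : v = T.start then Sum.inl S.finish else Sum.inr ⟨v, h⟩

/-- The product: `T` is glued to `S` start-to-end. -/
noncomputable def mul {X : Type u} (S T : XGraph X) : XGraph X where
  V := S.V ⊕ {v : T.V // v ≠ T.start}
  E := S.E ⊕ T.E
  src := Sum.elim (fun e => Sum.inl (S.src e)) (fun e => glueRight S T (T.src e))
  tgt := Sum.elim (fun e => Sum.inl (S.tgt e)) (fun e => glueRight S T (T.tgt e))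
  label := Sum.elim S.label T.label
  start := Sum.inl S.start
  finish := glueRight S T T.finish

/-- The end vertex is moved to the start vertex. -/
def plus {X : Type u} (T : XGraph X) : XGraph X := { T with finish := T.start }

/-- The start vertex is moved to the end vertex. -/
def star {X : Type u} (T : XGraph X) : XGraph X := { T with start := T.finish }

/-- The `X`-tree represented by a word. Up to isomorphism every `X`-tree (a finite tree with
directed, labelled edges and a directed path from start to end) arises in this way. -/
noncomputable def ofWord {X : Type u} : BiWord X → XGraph X
  | .one => trivial X
  | .of x => edge x
  | .mul s t => mul (ofWord s) (ofWord t)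
  | .plus s => plus (ofWord s)
  | .star s => star (ofWord s)

end XGraph

namespace FAd

/-- The element `m` of the free adequate monoid has `n` edges: it is represented by a
retract-free `X`-tree with exactly `n` edges. -/
def HasEdges {X : Type u} (m : FAd X) (n : ℕ) : Prop :=
  ∃ w : BiWord X, mk w = m ∧ (XGraph.ofWord w).RetractFree ∧
    Nat.card (XGraph.ofWord w).E = n

end FAd

/-! A word denotes a binary relation on the vertices of any graph: letters are adjacency, products
composition, `plus` and `star` the restrictions of the diagonal to domain and range. A pair of
vertices satisfies a word exactly when the tree of the word maps to the graph with start and end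
sent to that pair. The equational axioms hold for such relations in each graph. The quasi-identities
are verified for words that agree in all graphs: such words are compared in a tree, where directed
walks between two vertices are unique, and the result is carried along a map of that tree
(`Rel.satEquiv`). Hence equal elements have trees with morphisms both ways
(`nonempty_hom_of_mk_eq`).

For the lower bound, take trees that are zigzag paths with start and end at the first vertex and a
last vertex strictly higher than all others. Morphisms preserve height and cannot move a vertex
farther from the start. Between two such paths of equal length with morphisms both ways, the last
vertex goes to the last vertex, so everything is fixed. These paths therefore have no endomorphism
but the identity, represent distinct idempotents, and need all their edges. Counting them by final
height gives ballot numbers, whose sum telescopes to the middle binomial coefficient.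

For the upper bound, `plus` and `star` fix idempotents, so one unary operation per subword is
enough. A word of length `n` thus becomes a postfix program of length at most `4 * n` over a fixed
alphabet. Wallis' formula gives the asymptotics. -/

namespace XGraph

variable {X : Type u}

/-! ### Directed walks and acyclicity. -/

/-- `IsWalk G a l b`: the edges in `l` form a directed walk from `a` to `b`. -/
def IsWalk (G : XGraph X) : G.V → List G.E → G.V → Prop
  | a, [], b => a = b
  | a, e :: l, b => G.src e = a ∧ G.IsWalk (G.tgt e) l b

theorem IsWalk.append {G : XGraph X} {l l' : List G.E} {a b c : G.V} (h : G.IsWalk a l b)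
    (h' : G.IsWalk b l' c) : G.IsWalk a (l ++ l') c := by
  induction l generalizing a with
  | nil => obtain rfl : a = b := h; exact h'
  | cons e l ih => exact ⟨h.1, ih h.2⟩

theorem IsWalk.end_unique {G : XGraph X} {l : List G.E} {a b c : G.V} (h : G.IsWalk a l b)
    (h' : G.IsWalk a l c) : b = c := by
  induction l generalizing a with
  | nil => exact h.symm.trans h'
  | cons e l ih => exact ih h.2 h'.2

theorem IsWalk.exists_of_mem {G : XGraph X} {l : List G.E} {a b : G.V} {e : G.E}
    (h : G.IsWalk a l b) (he : e ∈ l) : ∃ l', G.IsWalk a l' (G.src e) := by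
  induction l generalizing a with
  | nil => simp at he
  | cons d l ih =>
    by_cases hed : e = d
    · subst hed
      exact ⟨[], h.1.symm⟩
    · obtain ⟨l', hl'⟩ := ih h.2 ((List.mem_cons.1 he).resolve_left hed)
      exact ⟨d :: l', h.1, hl'⟩

/-- A graph is acyclic if every function on its edges is the coboundary of a function on its
vertices. -/
def Acyclic (G : XGraph X) : Prop :=
  ∀ φ : G.E → ℤ, ∃ χ : G.V → ℤ, ∀ e, χ (G.tgt e) = χ (G.src e) + φ e

theorem IsWalk.potential {G : XGraph X} {φ : G.E → ℤ} {χ : G.V → ℤ}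
    (hχ : ∀ e, χ (G.tgt e) = χ (G.src e) + φ e) {l : List G.E} {a b : G.V}
    (h : G.IsWalk a l b) : χ b = χ a + (l.map φ).sum := by
  induction l generalizing a with
  | nil => obtain rfl : a = b := h; simp
  | cons e l ih =>
    rw [ih h.2, hχ, h.1, List.map_cons, List.sum_cons]; ring

/-- Directed walks in acyclic graphs are determined by their end points. -/
theorem IsWalk.unique {G : XGraph X} (hG : G.Acyclic) {l l' : List G.E} {a b : G.V}
    (h : G.IsWalk a l b) (h' : G.IsWalk a l' b) : l = l' := by
  classical
  -- A potential whose coboundary is the indicator of `e` shows that the number of passages through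
  -- `e` depends only on the end points.
  have hcount (e : G.E) {k k' : List G.E} {a b : G.V} (h : G.IsWalk a k b)
      (h' : G.IsWalk a k' b) : k.count e = k'.count e := by
    have hs (k : List G.E) : (k.map fun d => if d = e then (1 : ℤ) else 0).sum = k.count e := by
      induction k with
      | nil => simp
      | cons d k ih =>
        rw [List.map_cons, List.sum_cons, ih, List.count_cons]
        by_cases hd : d = e <;> simp [hd, add_comm]
    obtain ⟨χ, hχ⟩ := hG fun d => if d = e then 1 else 0
    have h₁ := h.potential hχ
    have h₂ := h'.potential hχ
    rw [hs] at h₁ h₂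
    omega
  have hclosed {k : List G.E} {a : G.V} (h : G.IsWalk a k a) : k = [] :=
    List.eq_nil_iff_forall_not_mem.2 fun e he => by
      have := hcount e h (show G.IsWalk a [] a from rfl)
      simp [List.count_eq_zero] at this
      exact this he
  induction l generalizing a l' with
  | nil => obtain rfl : a = b := h; exact (hclosed h').symm
  | cons e l ih =>
    cases l' with
    | nil => obtain rfl : a = b := h'; exact hclosed h
    | cons e' l' =>
      have he : e = e' := by
        by_contra hne
        -- The other walk also uses `e`. If `e` is not its first edge, the walk returns to `a`, the
        -- source of `e`, and so contains a nonempty closed walk.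
        have hmem : e ∈ e' :: l' := by
          rw [← List.count_pos_iff, ← hcount e h h']
          simp
        obtain ⟨k, hk⟩ := h'.2.exists_of_mem ((List.mem_cons.1 hmem).resolve_left hne)
        have hc : G.IsWalk a (e' :: k) a := ⟨h'.1, by rw [h.1] at hk; exact hk⟩
        simpa using hclosed hc
      subst he
      rw [ih h.2 h'.2]

theorem acyclic_mul {S T : XGraph X} (hS : S.Acyclic) (hT : T.Acyclic) : (mul S T).Acyclic := by
  intro φ
  obtain ⟨χ, hχ⟩ := hS fun e => φ (Sum.inl e)
  obtain ⟨ψ, hψ⟩ := hT fun e => φ (Sum.inr e)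
  have hg (v : T.V) : Sum.elim χ (fun v : {v : T.V // v ≠ T.start} =>
      ψ v - ψ T.start + χ S.finish) (glueRight S T v) = ψ v - ψ T.start + χ S.finish := by
    unfold glueRight
    split_ifs with h
    · simp [h]
    · simp
  -- The potential on `T` is shifted by a constant to agree with that on `S` at the common vertex.
  refine ⟨Sum.elim χ fun v => ψ v - ψ T.start + χ S.finish, ?_⟩
  rintro (e | e)
  · exact hχ e
  · refine (hg (T.tgt e)).trans ?_
    refine Eq.trans ?_ (congrArg (· + φ (Sum.inr e)) (hg (T.src e)).symm)
    simp only [hψ]; ring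

theorem acyclic_ofWord (w : BiWord X) : (ofWord w).Acyclic := by
  induction w with
  | one => exact fun φ => ⟨fun _ => 0, fun e => e.elim⟩
  | of x => exact fun φ => ⟨fun b => bif b then φ () else 0, fun _ => (zero_add _).symm⟩
  | mul s t hs ht => exact acyclic_mul hs ht
  | plus s hs => exact hs
  | star s hs => exact hs

/-! ### Maps out of trees, and words as relations. -/

/-- Maps between graphs that preserve incidence and labels, and send the start and end vertices
to prescribed vertices. -/
structure PointedMap (S G : XGraph X) (a b : G.V) where
  onV : S.V → G.V
  onE : S.E → G.E
  src_eq : ∀ e, G.src (onE e) = onV (S.src e)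
  tgt_eq : ∀ e, G.tgt (onE e) = onV (S.tgt e)
  label_eq : ∀ e, G.label (onE e) = S.label e
  start_eq : onV S.start = a
  finish_eq : onV S.finish = b

/-- Maps out of a product are pairs of maps that agree on the common vertex. -/
noncomputable def PointedMap.mul {S T G : XGraph X} {a b c : G.V} (f : PointedMap S G a b)
    (g : PointedMap T G b c) : PointedMap (XGraph.mul S T) G a c :=
  have hg (v : T.V) : Sum.elim f.onV (fun v : {v : T.V // v ≠ T.start} => g.onV v)
      (glueRight S T v) = g.onV v := by
    unfold glueRight
    split_ifs with h
    · simp [h, f.finish_eq, g.start_eq]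
    · simp
  { onV := Sum.elim f.onV fun v => g.onV v
    onE := Sum.elim f.onE g.onE
    src_eq := by
      rintro (e | e)
      · exact f.src_eq e
      · exact (g.src_eq e).trans (hg _).symm
    tgt_eq := by
      rintro (e | e)
      · exact f.tgt_eq e
      · exact (g.tgt_eq e).trans (hg _).symm
    label_eq := by
      rintro (e | e)
      · exact f.label_eq e
      · exact g.label_eq e
    start_eq := f.start_eq
    finish_eq := (hg _).trans g.finish_eq }

theorem glueRight_start (S T : XGraph X) : glueRight S T T.start = Sum.inl S.finish := by
  simp [glueRight]

end XGraph

namespace BiWord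

variable {X : Type u}

open XGraph

/-- The relation on the vertices of a graph denoted by a word: letters denote adjacency, products
composition, `plus` the domain and `star` the range. -/
def Sat (G : XGraph X) : BiWord X → G.V → G.V → Prop
  | one, a, b => a = b
  | of x, a, b => ∃ e, G.src e = a ∧ G.tgt e = b ∧ G.label e = x
  | mul s t, a, b => ∃ c, s.Sat G a c ∧ t.Sat G c b
  | plus s, a, b => a = b ∧ ∃ c, s.Sat G a c
  | star s, a, b => a = b ∧ ∃ c, s.Sat G c a

theorem Sat.map {G H : XGraph X} (fV : G.V → H.V) (fE : G.E → H.E)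
    (hsrc : ∀ e, H.src (fE e) = fV (G.src e)) (htgt : ∀ e, H.tgt (fE e) = fV (G.tgt e))
    (hlabel : ∀ e, H.label (fE e) = G.label e) {w : BiWord X} {a b : G.V} (h : w.Sat G a b) :
    w.Sat H (fV a) (fV b) := by
  induction w generalizing a b with
  | one => exact congrArg fV h
  | of x =>
    obtain ⟨e, rfl, rfl, rfl⟩ := h
    exact ⟨fE e, hsrc e, htgt e, hlabel e⟩
  | mul s t hs ht => obtain ⟨c, h₁, h₂⟩ := h; exact ⟨fV c, hs h₁, ht h₂⟩
  | plus s hs => obtain ⟨rfl, c, hc⟩ := h; exact ⟨rfl, fV c, hs hc⟩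
  | star s hs => obtain ⟨rfl, c, hc⟩ := h; exact ⟨rfl, fV c, hs hc⟩

theorem Sat.inl {S : XGraph X} (T : XGraph X) {w : BiWord X} {a b : S.V} (h : w.Sat S a b) :
    w.Sat (XGraph.mul S T) (Sum.inl a) (Sum.inl b) :=
  h.map (H := XGraph.mul S T) Sum.inl Sum.inl (fun _ => rfl) (fun _ => rfl) fun _ => rfl

theorem Sat.glueRight (S : XGraph X) {T : XGraph X} {w : BiWord X} {a b : T.V}
    (h : w.Sat T a b) : w.Sat (XGraph.mul S T) (XGraph.glueRight S T a) (XGraph.glueRight S T b) :=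
  h.map (H := XGraph.mul S T) (XGraph.glueRight S T) Sum.inr (fun _ => rfl) (fun _ => rfl)
    fun _ => rfl

/-- The start and end vertices of the tree of a word satisfy the word. -/
theorem sat_ofWord (w : BiWord X) : w.Sat (ofWord w) (ofWord w).start (ofWord w).finish := by
  induction w with
  | one => rfl
  | of x => exact ⟨(), rfl, rfl, rfl⟩
  | mul s t hs ht =>
    refine ⟨Sum.inl (ofWord s).finish, hs.inl _, ?_⟩
    have := ht.glueRight (ofWord s)
    rwa [glueRight_start] at this
  | plus s hs =>
    exact ⟨rfl, _, hs.map (G := ofWord s) (H := (ofWord s).plus) id id (fun _ => rfl)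
      (fun _ => rfl) fun _ => rfl⟩
  | star s hs =>
    exact ⟨rfl, _, hs.map (G := ofWord s) (H := (ofWord s).star) id id (fun _ => rfl)
      (fun _ => rfl) fun _ => rfl⟩

/-- The tree of a word maps to any pair of vertices that satisfies the word. -/
theorem Sat.nonempty_pointedMap {G : XGraph X} {w : BiWord X} {a b : G.V} (h : w.Sat G a b) :
    Nonempty (PointedMap (ofWord w) G a b) := by
  induction w generalizing a b with
  | one => exact ⟨⟨fun _ => a, Empty.elim, nofun, nofun, nofun, rfl, h⟩⟩
  | of x =>
    obtain ⟨e, rfl, rfl, rfl⟩ := h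
    exact ⟨⟨fun v => bif v then G.tgt e else G.src e, fun _ => e, fun _ => rfl, fun _ => rfl,
      fun _ => rfl, rfl, rfl⟩⟩
  | mul s t hs ht =>
    obtain ⟨c, h₁, h₂⟩ := h
    obtain ⟨f⟩ := hs h₁
    obtain ⟨g⟩ := ht h₂
    exact ⟨f.mul g⟩
  | plus s hs =>
    obtain ⟨rfl, c, hc⟩ := h
    obtain ⟨f⟩ := hs hc
    exact ⟨⟨f.onV, f.onE, f.src_eq, f.tgt_eq, f.label_eq, f.start_eq, f.start_eq⟩⟩
  | star s hs =>
    obtain ⟨rfl, c, hc⟩ := h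
    obtain ⟨f⟩ := hs hc
    exact ⟨⟨f.onV, f.onE, f.src_eq, f.tgt_eq, f.label_eq, f.finish_eq, f.finish_eq⟩⟩

/-- The length of the directed path from start to end in the tree of a word. -/
def trunkLength : BiWord X → ℕ
  | one => 0
  | of _ => 1
  | mul s t => s.trunkLength + t.trunkLength
  | plus _ => 0
  | star _ => 0

theorem Sat.exists_isWalk {G : XGraph X} {w : BiWord X} {a b : G.V} (h : w.Sat G a b) :
    ∃ l, G.IsWalk a l b ∧ l.length = w.trunkLength := by
  induction w generalizing a b with
  | one => exact ⟨[], h, rfl⟩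
  | of x => obtain ⟨e, rfl, rfl, rfl⟩ := h; exact ⟨[e], ⟨rfl, rfl⟩, rfl⟩
  | mul s t hs ht =>
    obtain ⟨c, h₁, h₂⟩ := h
    obtain ⟨l, hl, hl'⟩ := hs h₁
    obtain ⟨k, hk, hk'⟩ := ht h₂
    exact ⟨l ++ k, hl.append hk, by simp [hl', hk', trunkLength]⟩
  | plus s hs => exact ⟨[], h.1, rfl⟩
  | star s hs => exact ⟨[], h.1, rfl⟩

/-- Two words are equivalent if they denote the same relation in every graph. -/
def SatEquiv (s t : BiWord X) : Prop := ∀ (G : XGraph X) (a b : G.V), s.Sat G a b ↔ t.Sat G a b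

/-- In the tree of `s`, both words yield a directed walk from start to end, and that walk is unique.
-/
theorem SatEquiv.trunkLength_eq {s t : BiWord X} (h : SatEquiv s t) :
    s.trunkLength = t.trunkLength := by
  obtain ⟨l, hl, hl'⟩ := (sat_ofWord s).exists_isWalk
  obtain ⟨k, hk, hk'⟩ := ((h _ _ _).1 (sat_ofWord s)).exists_isWalk
  rw [← hl', ← hk', hl.unique (acyclic_ofWord s) hk]

/-- In an acyclic graph, the vertex that factors a pair of vertices through `s` and `t` depends
only on the trunk lengths of `s` and `t`. -/
theorem Sat.mid_unique {G : XGraph X} (hG : G.Acyclic) {s t s' t' : BiWord X} {a b c b' : G.V}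
    (hs : s.Sat G a b) (ht : t.Sat G b c) (hs' : s'.Sat G a b') (ht' : t'.Sat G b' c)
    (h : s.trunkLength = s'.trunkLength) : b = b' := by
  obtain ⟨l, hl, hl₁⟩ := hs.exists_isWalk
  obtain ⟨k, hk, -⟩ := ht.exists_isWalk
  obtain ⟨l', hl', hl₁'⟩ := hs'.exists_isWalk
  obtain ⟨k', hk', -⟩ := ht'.exists_isWalk
  have := (List.append_inj ((hl.append hk).unique hG (hl'.append hk')) (by omega)).1
  subst this
  exact hl.end_unique hl'

/-- The hypothesis is applied in the tree of `x.mul z`, whose start and end factor through some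
vertex by `y` and `z`. Since `x` and `y` have equal trunk lengths, that vertex is the gluing vertex.
So `y` holds from the start to the gluing vertex, and a map of the tree to `G` transports this. -/
theorem SatEquiv.sat_mul_plus {x y z : BiWord X} (h : SatEquiv (x.mul z) (y.mul z))
    {G : XGraph X} {a b : G.V} (hx : (x.mul z.plus).Sat G a b) : (y.mul z.plus).Sat G a b := by
  obtain ⟨_, hx, rfl, c, hz⟩ := hx
  obtain ⟨f⟩ := hx.nonempty_pointedMap
  obtain ⟨g⟩ := hz.nonempty_pointedMap
  have hlen := h.trunkLength_eq
  obtain ⟨j, h₁, h₂⟩ := (h _ _ _).1 (sat_ofWord (x.mul z))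
  have hz' := (sat_ofWord z).glueRight (ofWord x)
  rw [glueRight_start] at hz'
  have hj := ((sat_ofWord x).inl (ofWord z)).mid_unique (acyclic_ofWord (x.mul z)) hz' h₁ h₂
    (by simpa [trunkLength] using hlen)
  subst hj
  have h₃ := h₁.map (f.mul g).onV (f.mul g).onE (f.mul g).src_eq (f.mul g).tgt_eq
    (f.mul g).label_eq
  refine ⟨_, ?_, rfl, c, hz⟩
  have e₁ : (f.mul g).onV (ofWord (x.mul z)).start = a := (f.mul g).start_eq
  have e₂ : (f.mul g).onV (Sum.inl (ofWord x).finish) = _ := f.finish_eq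
  rwa [e₁, e₂] at h₃

theorem SatEquiv.sat_star_mul {x y z : BiWord X} (h : SatEquiv (z.mul x) (z.mul y))
    {G : XGraph X} {a b : G.V} (hx : (z.star.mul x).Sat G a b) : (z.star.mul y).Sat G a b := by
  obtain ⟨_, ⟨rfl, c, hz⟩, hx⟩ := hx
  obtain ⟨f⟩ := hz.nonempty_pointedMap
  obtain ⟨g⟩ := hx.nonempty_pointedMap
  obtain ⟨j, h₁, h₂⟩ := (h _ _ _).1 (sat_ofWord (z.mul x))
  have hx' := (sat_ofWord x).glueRight (ofWord z)
  rw [glueRight_start] at hx'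
  have hj := ((sat_ofWord z).inl (ofWord x)).mid_unique (acyclic_ofWord (z.mul x)) hx' h₁ h₂ rfl
  subst hj
  have h₃ := h₂.map (f.mul g).onV (f.mul g).onE (f.mul g).src_eq (f.mul g).tgt_eq
    (f.mul g).label_eq
  refine ⟨_, ⟨rfl, c, hz⟩, ?_⟩
  have e₁ : (f.mul g).onV (Sum.inl (ofWord z).finish) = a := f.finish_eq
  have e₂ : (f.mul g).onV (ofWord (z.mul x)).finish = b := (f.mul g).finish_eq
  rwa [e₁, e₂] at h₃

/-- The trunk length equals its double, so it is zero. -/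
theorem SatEquiv.eq_of_idem {x : BiWord X} (h : SatEquiv (x.mul x) x) {G : XGraph X} {a b : G.V}
    (hx : x.Sat G a b) : a = b := by
  have hlen := h.trunkLength_eq
  obtain ⟨l, hl, hl'⟩ := hx.exists_isWalk
  simp only [trunkLength] at hlen
  obtain rfl : l = [] := List.length_eq_zero_iff.1 (by omega)
  exact hl

/-- Words that are equal in the free adequate monoid denote the same relations. -/
theorem Rel.satEquiv {s t : BiWord X} (h : Rel s t) : SatEquiv s t := by
  induction h with
  | refl s => exact fun _ _ _ => Iff.rfl
  | symm _ ih => exact fun G a b => (ih G a b).symm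
  | trans _ _ ih₁ ih₂ => exact fun G a b => (ih₁ G a b).trans (ih₂ G a b)
  | mul _ _ ih₁ ih₂ => exact fun G a b => by simp only [Sat, ih₁ G, ih₂ G]
  | plus _ ih => exact fun G a b => by simp only [Sat, ih G]
  | star _ ih => exact fun G a b => by simp only [Sat, ih G]
  | eq_plus_of_idem _ ih =>
    refine fun G a b => ⟨fun hx => ⟨ih.eq_of_idem hx, b, hx⟩, ?_⟩
    rintro ⟨rfl, c, hc⟩
    obtain rfl := ih.eq_of_idem hc
    exact hc
  | eq_star_of_idem _ ih =>
    refine fun G a b => ⟨fun hx => ?_, ?_⟩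
    · obtain rfl := ih.eq_of_idem hx
      exact ⟨rfl, _, hx⟩
    rintro ⟨rfl, c, hc⟩
    obtain rfl := ih.eq_of_idem hc
    exact hc
  | mul_plus_of_mul_eq _ ih =>
    exact fun G a b => ⟨ih.sat_mul_plus, SatEquiv.sat_mul_plus fun G a b => (ih G a b).symm⟩
  | star_mul_of_mul_eq _ ih =>
    exact fun G a b => ⟨ih.sat_star_mul, SatEquiv.sat_star_mul fun G a b => (ih G a b).symm⟩
  -- The remaining axioms are identities of binary relations.
  | _ => intro G a b; simp only [Sat]; grind

end BiWord

namespace FAd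

variable {X : Type u}

/-- Words that represent the same element of the free adequate monoid have trees with morphisms
between them. -/
theorem nonempty_hom_of_mk_eq {s t : BiWord X} (h : mk s = mk t) :
    Nonempty (XGraph.Hom (XGraph.ofWord s) (XGraph.ofWord t)) := by
  obtain ⟨f⟩ := ((BiWord.Rel.satEquiv (Quotient.exact h) _ _ _).2
    (BiWord.sat_ofWord t)).nonempty_pointedMap
  exact ⟨⟨f.onV, f.onE, f.src_eq, f.tgt_eq, f.label_eq, f.start_eq, f.finish_eq⟩⟩

end FAd

namespace XGraph

variable {X : Type u}

theorem finite_ofWord_E (w : BiWord X) : Finite (ofWord w).E := by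
  induction w with
  | one => exact inferInstanceAs (Finite Empty)
  | of x => exact inferInstanceAs (Finite Unit)
  | mul s t hs ht => exact inferInstanceAs (Finite ((ofWord s).E ⊕ (ofWord t).E))
  | plus s hs => exact hs
  | star s hs => exact hs

/-- This lets the bounds by word length and by number of edges share one argument. -/
theorem card_ofWord_E (w : BiWord X) : Nat.card (ofWord w).E = w.length := by
  induction w with
  | one => exact Nat.card_of_isEmpty (α := Empty)
  | of x => exact Nat.card_unique (α := Unit)
  | mul s t hs ht =>
    have := finite_ofWord_E s
    have := finite_ofWord_E t
    exact Nat.card_sum.trans (by rw [hs, ht]; rfl)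
  | plus s hs => exact hs
  | star s hs => exact hs

end XGraph

/-! ### Zigzag paths and their morphisms. -/

/-- The height reached by a zigzag path, where `true` is a step up and `false` a step down. -/
def zigzagHeight (l : List Bool) : ℤ := (l.map fun b => if b then (1 : ℤ) else -1).sum

theorem zigzagHeight_cons (b : Bool) (l : List Bool) :
    zigzagHeight (b :: l) = (if b then 1 else -1) + zigzagHeight l := by
  simp [zigzagHeight]

theorem zigzagHeight_append (l l' : List Bool) :
    zigzagHeight (l ++ l') = zigzagHeight l + zigzagHeight l' := by
  simp [zigzagHeight]

theorem zigzagHeight_take_succ {l : List Bool} {i : ℕ} {b : Bool} (h : l[i]? = some b) :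
    zigzagHeight (l.take (i + 1)) = zigzagHeight (l.take i) + if b then 1 else -1 := by
  rw [List.take_add_one, zigzagHeight_append, h]
  simp [zigzagHeight]

/-- The end point of the zigzag path is strictly higher than all other vertices. -/
def EndsHighest (l : List Bool) : Prop :=
  ∀ i < l.length, zigzagHeight (l.take i) < zigzagHeight l

/-- The idempotent word whose tree is a zigzag path, with start and end at its first vertex. -/
def zigzag : List Bool → BiWord Unit
  | [] => .one
  | true :: l => .plus (.mul (.of ()) (zigzag l))
  | false :: l => .star (.mul (zigzag l) (.of ()))

theorem length_zigzag (l : List Bool) : (zigzag l).length = l.length := by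
  induction l with
  | nil => rfl
  | cons b l ih => cases b <;> simp [zigzag, BiWord.length, ih, add_comm]

namespace XGraph

/-- The vertices `p 0, p 1, …` form a zigzag path with the directions given by `l`, which is all
of `G`. -/
structure IsZigzag (G : XGraph Unit) (l : List Bool) (p : ℕ → G.V) : Prop where
  start_eq : G.start = p 0
  finish_eq : G.finish = p 0
  exists_edge : ∀ (i : ℕ) (b : Bool), l[i]? = some b →
    ∃ d, G.src d = p (if b then i else i + 1) ∧ G.tgt d = p (if b then i + 1 else i)
  edge_eq : ∀ d, ∃ (i : ℕ) (b : Bool), l[i]? = some b ∧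
    G.src d = p (if b then i else i + 1) ∧ G.tgt d = p (if b then i + 1 else i)
  edge_unique : ∀ d d', G.src d = G.src d' → G.tgt d = G.tgt d' → d = d'
  vertex_eq : ∀ v, ∃ i ≤ l.length, v = p i
  inj : ∀ i ≤ l.length, ∀ j ≤ l.length, p i = p j → i = j

theorem glueRight_of_ne {S T : XGraph Unit} {v : T.V} (h : v ≠ T.start) :
    glueRight S T v = Sum.inr ⟨v, h⟩ := by
  simp [glueRight, h]

theorem glueRight_injective (S T : XGraph Unit) : Function.Injective (glueRight S T) := by
  intro v w h
  unfold glueRight at h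
  split_ifs at h with h₁ h₂ h₂
  · rw [h₁, h₂]
  · simpa using h

/-- Adding a first edge to a zigzag path. -/
theorem IsZigzag.cons {G H : XGraph Unit} {l : List Bool} {p : ℕ → G.V} (hG : G.IsZigzag l p)
    (b : Bool) (r : H.V) (ι : G.V → H.V) (hι : Function.Injective ι) (hr : ∀ v, r ≠ ι v)
    (hV : ∀ v, v = r ∨ ∃ w, v = ι w) (hstart : H.start = r) (hfinish : H.finish = r)
    (d₀ : H.E) (κ : G.E → H.E) (hE : ∀ d, d = d₀ ∨ ∃ d', d = κ d')
    (hsrc : ∀ d, H.src (κ d) = ι (G.src d)) (htgt : ∀ d, H.tgt (κ d) = ι (G.tgt d))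
    (hsrc₀ : H.src d₀ = if b then r else ι (p 0)) (htgt₀ : H.tgt d₀ = if b then ι (p 0) else r) :
    H.IsZigzag (b :: l) fun i => i.casesOn r fun i => ι (p i) where
  start_eq := hstart
  finish_eq := hfinish
  exists_edge i c h := by
    rcases i with - | i
    · obtain rfl : b = c := by simpa using h
      exact ⟨d₀, by rw [hsrc₀]; cases b <;> rfl, by rw [htgt₀]; cases b <;> rfl⟩
    · obtain ⟨d, h₁, h₂⟩ := hG.exists_edge i c (by simpa using h)
      exact ⟨κ d, by rw [hsrc, h₁]; cases c <;> rfl, by rw [htgt, h₂]; cases c <;> rfl⟩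
  edge_eq d := by
    obtain rfl | ⟨d, rfl⟩ := hE d
    · exact ⟨0, b, rfl, by rw [hsrc₀]; cases b <;> rfl, by rw [htgt₀]; cases b <;> rfl⟩
    · obtain ⟨i, c, h, h₁, h₂⟩ := hG.edge_eq d
      exact ⟨i + 1, c, by simpa using h, by rw [hsrc, h₁]; cases c <;> rfl,
        by rw [htgt, h₂]; cases c <;> rfl⟩
  edge_unique d d' h₁ h₂ := by
    obtain rfl | ⟨d, rfl⟩ := hE d <;> obtain rfl | ⟨d', rfl⟩ := hE d'
    · rfl
    · rw [hsrc, hsrc₀] at h₁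
      rw [htgt, htgt₀] at h₂
      cases b
      · exact absurd h₂ (hr _)
      · exact absurd h₁ (hr _)
    · rw [hsrc, hsrc₀] at h₁
      rw [htgt, htgt₀] at h₂
      cases b
      · exact absurd h₂.symm (hr _)
      · exact absurd h₁.symm (hr _)
    · rw [hsrc, hsrc] at h₁
      rw [htgt, htgt] at h₂
      rw [hG.edge_unique d d' (hι h₁) (hι h₂)]
  vertex_eq v := by
    obtain rfl | ⟨w, rfl⟩ := hV v
    · exact ⟨0, Nat.zero_le _, rfl⟩
    · obtain ⟨i, hi, rfl⟩ := hG.vertex_eq w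
      exact ⟨i + 1, by simpa using hi, rfl⟩
  inj i hi j hj h := by
    rcases i with - | i <;> rcases j with - | j
    · rfl
    · exact absurd h (hr _)
    · exact absurd h.symm (hr _)
    · rw [hG.inj i (by simpa using hi) j (by simpa using hj) (hι h)]

theorem exists_isZigzag (l : List Bool) : ∃ p, IsZigzag (ofWord (zigzag l)) l p := by
  induction l with
  | nil =>
    exact ⟨fun _ => (), rfl, rfl, by simp, nofun, nofun, fun _ => ⟨0, le_rfl, rfl⟩,
      fun i hi j hj _ => by simp at hi hj; omega⟩
  | cons b l ih =>
    obtain ⟨p, hp⟩ := ih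
    cases b
    -- The edge is glued on after the path, so the new first vertex is the target of the edge, in
    -- the right summand.
    · have hne : true ≠ (edge ()).start := fun h => Bool.noConfusion h
      refine ⟨_, hp.cons (H := ofWord (zigzag (false :: l))) false (Sum.inr ⟨true, hne⟩) Sum.inl
        Sum.inl_injective (fun _ => Sum.inr_ne_inl) ?_ (glueRight_of_ne hne) (glueRight_of_ne hne)
        (Sum.inr ()) Sum.inl ?_ (fun _ => rfl) (fun _ => rfl) ?_ (glueRight_of_ne hne)⟩
      · rintro (v | ⟨v, hv⟩)
        · exact Or.inr ⟨v, rfl⟩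
        · left
          cases v
          · exact absurd rfl hv
          · rfl
      · rintro (d | d)
        · exact Or.inr ⟨d, rfl⟩
        · exact Or.inl rfl
      · exact (glueRight_start (ofWord (zigzag l)) (edge ())).trans (congrArg Sum.inl hp.finish_eq)
    · refine ⟨_, hp.cons (H := ofWord (zigzag (true :: l))) true (Sum.inl false)
        (glueRight (edge ()) (ofWord (zigzag l))) (glueRight_injective _ _) ?_ ?_ rfl rfl
        (Sum.inl ()) Sum.inr ?_ (fun _ => rfl) (fun _ => rfl) rfl ?_⟩
      · intro v h
        unfold glueRight at h
        split_ifs at h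
        exact Bool.noConfusion (Sum.inl_injective h : false = true)
      · rintro (v | ⟨v, hv⟩)
        · cases v
          · exact Or.inl rfl
          · exact Or.inr ⟨_, (glueRight_start (edge ()) (ofWord (zigzag l))).symm⟩
        · exact Or.inr ⟨v, (glueRight_of_ne hv).symm⟩
      · rintro (d | d)
        · exact Or.inl rfl
        · exact Or.inr ⟨d, rfl⟩
      · exact (glueRight_start (edge ()) (ofWord (zigzag l))).symm.trans
          (congrArg _ hp.start_eq)

/-- Morphisms from a zigzag path preserve heights and do not increase the distance from the start
vertex. -/
theorem IsZigzag.exists_map_eq {G G' : XGraph Unit} {l l' : List Bool} {p : ℕ → G.V}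
    {p' : ℕ → G'.V} (hG : G.IsZigzag l p) (hG' : G'.IsZigzag l' p') (f : Hom G G') {i : ℕ}
    (hi : i ≤ l.length) : ∃ j ≤ l'.length, j ≤ i ∧ f.onV (p i) = p' j ∧
      zigzagHeight (l'.take j) = zigzagHeight (l.take i) := by
  induction i with
  | zero =>
    exact ⟨0, Nat.zero_le _, le_rfl, by rw [← hG.start_eq, f.start_eq, hG'.start_eq], rfl⟩
  | succ i ih =>
    obtain ⟨j, hj, hji, hfj, hh⟩ := ih (by omega)
    have hb : l[i]? = some l[i] := List.getElem?_eq_getElem (by omega)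
    obtain ⟨d, h₁, h₂⟩ := hG.exists_edge i _ hb
    obtain ⟨k, c, hc, h₃, h₄⟩ := hG'.edge_eq (f.onE d)
    have hk : k < l'.length := (List.getElem?_eq_some_iff.1 hc).1
    rw [f.src_eq, h₁] at h₃
    rw [f.tgt_eq, h₂] at h₄
    have hl := zigzagHeight_take_succ hb
    have hl' := zigzagHeight_take_succ hc
    generalize l[i] = b at *
    -- The image edge is traversed away from the start if `b = c` and towards it otherwise. The
    -- vertex `p i` is the source of the edge if `b` is `true` and its target if not, which decides
    -- whether `h₃` or `h₄` identifies `j`.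
    cases b <;> cases c <;> simp only [if_true, if_false, Bool.false_eq_true] at * <;>
      first
      | (have hjk := hG'.inj _ hj _ (by omega) (hfj.symm.trans h₃)
         exact ⟨_, by omega, by omega, h₄, by subst hjk; omega⟩)
      | (have hjk := hG'.inj _ hj _ (by omega) (hfj.symm.trans h₄)
         exact ⟨_, by omega, by omega, h₃, by subst hjk; omega⟩)

/-- A morphism of zigzag paths of the same length that preserves the last vertex preserves all
vertices and directions. -/
theorem IsZigzag.map_eq {G G' : XGraph Unit} {l l' : List Bool} {p : ℕ → G.V}
    {p' : ℕ → G'.V} (hG : G.IsZigzag l p) (hG' : G'.IsZigzag l' p') (f : Hom G G')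
    (hlen : l.length = l'.length) (hlast : f.onV (p l.length) = p' l'.length) {i : ℕ}
    (hi : i ≤ l.length) : f.onV (p i) = p' i ∧ ∀ j, i ≤ j → l[j]? = l'[j]? := by
  induction hi using Nat.decreasingInduction with
  | self =>
    refine ⟨hlen ▸ hlast, fun j hj => ?_⟩
    rw [List.getElem?_eq_none (by omega), List.getElem?_eq_none (by omega)]
  | of_succ i hi ih =>
    obtain ⟨j, hj, hji, hfj, -⟩ := hG.exists_map_eq hG' f hi.le
    have hb : l[i]? = some l[i] := List.getElem?_eq_getElem (by omega)
    obtain ⟨d, h₁, h₂⟩ := hG.exists_edge i _ hb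
    obtain ⟨k, c, hc, h₃, h₄⟩ := hG'.edge_eq (f.onE d)
    have hk : k < l'.length := (List.getElem?_eq_some_iff.1 hc).1
    rw [f.src_eq, h₁] at h₃
    rw [f.tgt_eq, h₂] at h₄
    -- The image of `p i` has index at most `i` and is adjacent to `p' (i + 1)`, which leaves only
    -- `p' i`.
    suffices h : j = i ∧ l[i]? = l'[i]? by
      refine ⟨h.1 ▸ hfj, fun m hm => ?_⟩
      obtain rfl | hm := hm.eq_or_lt
      · exact h.2
      · exact ih.2 m hm
    rw [hb]
    generalize l[i] = b at *
    have hi' := ih.1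
    cases b <;> cases c <;> simp only [if_true, if_false, Bool.false_eq_true] at h₃ h₄ <;>
      first
      | (have h₅ := hG'.inj _ hj _ (by omega) (hfj.symm.trans h₃)
         have h₆ := hG'.inj _ (by omega) _ (by omega) (hi'.symm.trans h₄)
         first
         | omega
         | (obtain rfl : k = i := by omega
            exact ⟨by omega, hc.symm⟩))
      | (have h₅ := hG'.inj _ hj _ (by omega) (hfj.symm.trans h₄)
         have h₆ := hG'.inj _ (by omega) _ (by omega) (hi'.symm.trans h₃)
         first
         | omega
         | (obtain rfl : k = i := by omega
            exact ⟨by omega, hc.symm⟩))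

/-- The last vertex of the first path has an image of the same height, and the second path rises no
higher than its end. -/
theorem IsZigzag.height_le {G G' : XGraph Unit} {l l' : List Bool} {p : ℕ → G.V}
    {p' : ℕ → G'.V} (hG : G.IsZigzag l p) (hG' : G'.IsZigzag l' p') (f : Hom G G')
    (hl' : EndsHighest l') : zigzagHeight l ≤ zigzagHeight l' := by
  obtain ⟨j, hj, -, -, hh⟩ := hG.exists_map_eq hG' f le_rfl
  rw [List.take_length] at hh
  obtain rfl | hj := hj.eq_or_lt
  · rw [List.take_length] at hh; exact hh.ge
  · exact hh ▸ (hl' j hj).le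

theorem IsZigzag.map_last {G G' : XGraph Unit} {l l' : List Bool} {p : ℕ → G.V}
    {p' : ℕ → G'.V} (hG : G.IsZigzag l p) (hG' : G'.IsZigzag l' p') (f : Hom G G')
    (hl' : EndsHighest l') (h : zigzagHeight l = zigzagHeight l') :
    f.onV (p l.length) = p' l'.length := by
  obtain ⟨j, hj, -, hfj, hh⟩ := hG.exists_map_eq hG' f le_rfl
  rw [List.take_length] at hh
  obtain rfl | hj := hj.eq_or_lt
  · exact hfj
  · have := hl' j hj
    omega

/-- The only endomorphism of a zigzag path that ends at its highest vertex is the identity. -/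
theorem IsZigzag.endo_eq {G : XGraph Unit} {l : List Bool} {p : ℕ → G.V} (hG : G.IsZigzag l p)
    (hl : EndsHighest l) (f : Hom G G) : (∀ v, f.onV v = v) ∧ ∀ d, f.onE d = d := by
  have hV (v : G.V) : f.onV v = v := by
    obtain ⟨i, hi, rfl⟩ := hG.vertex_eq v
    exact (hG.map_eq hG f rfl (hG.map_last hG f hl rfl) hi).1
  exact ⟨hV, fun d => hG.edge_unique _ _ (by rw [f.src_eq, hV]) (by rw [f.tgt_eq, hV])⟩

/-- The composite of two morphisms. -/
def Hom.comp {G H K : XGraph Unit} (g : Hom H K) (f : Hom G H) : Hom G K where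
  onV v := g.onV (f.onV v)
  onE e := g.onE (f.onE e)
  src_eq e := by rw [g.src_eq, f.src_eq]
  tgt_eq e := by rw [g.tgt_eq, f.tgt_eq]
  label_eq e := by rw [g.label_eq, f.label_eq]
  start_eq := by rw [f.start_eq, g.start_eq]
  finish_eq := by rw [f.finish_eq, g.finish_eq]

end XGraph

namespace FAd

open XGraph

/-- Zigzag words of the same length whose paths end at their highest vertices represent distinct
elements. -/
theorem eq_of_mk_zigzag_eq {l l' : List Bool} (hl : EndsHighest l) (hl' : EndsHighest l')
    (hlen : l.length = l'.length) (h : mk (zigzag l) = mk (zigzag l')) : l = l' := by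
  obtain ⟨f⟩ := nonempty_hom_of_mk_eq h
  obtain ⟨g⟩ := nonempty_hom_of_mk_eq h.symm
  obtain ⟨p, hp⟩ := exists_isZigzag l
  obtain ⟨p', hp'⟩ := exists_isZigzag l'
  have hh := (hp.height_le hp' f hl').antisymm (hp'.height_le hp g hl)
  exact List.ext_getElem? fun j =>
    (hp.map_eq hp' f hlen (hp.map_last hp' f hl' hh) (Nat.zero_le _)).2 j (Nat.zero_le j)

theorem retractFree_zigzag {l : List Bool} (hl : EndsHighest l) :
    (ofWord (zigzag l)).RetractFree := by
  obtain ⟨p, hp⟩ := exists_isZigzag l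
  exact fun f _ => hp.endo_eq hl f

/-- The zigzag tree maps to the tree of `w` and back. The composite is the identity, so the first
map is injective on edges. -/
theorem length_le_of_mk_eq_zigzag {l : List Bool} (hl : EndsHighest l) {w : BiWord Unit}
    (h : mk w = mk (zigzag l)) : l.length ≤ w.length := by
  obtain ⟨f⟩ := nonempty_hom_of_mk_eq h
  obtain ⟨g⟩ := nonempty_hom_of_mk_eq h.symm
  obtain ⟨p, hp⟩ := exists_isZigzag l
  have := finite_ofWord_E w
  have hinj : Function.Injective g.onE := Function.LeftInverse.injective
    (g := f.onE) (hp.endo_eq hl (f.comp g)).2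
  have := Nat.card_le_card_of_injective _ hinj
  rwa [card_ofWord_E, card_ofWord_E, length_zigzag] at this

theorem isIdempotentElem_plus {M : Type*} [AdequateMonoid M] (x : M) :
    IsIdempotentElem (AdequateMonoid.plus x) := by
  have h := AdequateMonoid.plus_mul (AdequateMonoid.plus x) x
  rw [AdequateMonoid.plus_mul_self, AdequateMonoid.plus_plus_mul_plus] at h
  exact h.symm

theorem isIdempotentElem_star {M : Type*} [AdequateMonoid M] (x : M) :
    IsIdempotentElem (AdequateMonoid.star x) := by
  have h := AdequateMonoid.star_mul x (AdequateMonoid.star x)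
  rw [AdequateMonoid.mul_star_self, AdequateMonoid.star_star_mul_star] at h
  exact h.symm

theorem isIdempotentElem_zigzag (l : List Bool) : IsIdempotentElem (mk (zigzag l)) := by
  match l with
  | [] => exact one_mul (1 : FAd Unit)
  | true :: l => exact isIdempotentElem_plus (mk (.mul (.of ()) (zigzag l)))
  | false :: l => exact isIdempotentElem_star (mk (.mul (zigzag l) (.of ())))

theorem zigzag_mem_idempotentSphere {l : List Bool} (hl : EndsHighest l) :
    mk (zigzag l) ∈ idempotentSphere Unit l.length := by
  refine ⟨⟨⟨zigzag l, (length_zigzag l).le, rfl⟩, ?_⟩, isIdempotentElem_zigzag l⟩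
  rintro k hk ⟨w, hw, h⟩
  exact absurd (length_le_of_mk_eq_zigzag hl h) (by omega)

theorem hasEdges_zigzag {l : List Bool} (hl : EndsHighest l) :
    (mk (zigzag l)).HasEdges l.length :=
  ⟨zigzag l, rfl, retractFree_zigzag hl, by rw [card_ofWord_E, length_zigzag]⟩

end FAd

/-! ### Counting zigzag paths that end at their highest vertex. -/

/-- The lists of length `m` and height `s` that end at their highest vertex. -/
def endsHighestLists : ℕ → ℕ → Finset (List Bool)
  | 0, 0 => {[]}
  | 0, _ + 1 => ∅
  | _ + 1, 0 => ∅
  | m + 1, s + 1 => (endsHighestLists m s).map ⟨List.cons true, List.cons_injective⟩ ∪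
      (endsHighestLists m (s + 2)).map ⟨List.cons false, List.cons_injective⟩

theorem mem_endsHighestLists {m s : ℕ} {l : List Bool} (h : l ∈ endsHighestLists m s) :
    l.length = m ∧ zigzagHeight l = s ∧ EndsHighest l := by
  -- The end is strictly highest when every nonempty suffix has positive height. In this form the
  -- condition passes between a list and its tail.
  suffices h : l.length = m ∧ zigzagHeight l = s ∧ ∀ i < l.length, 0 < zigzagHeight (l.drop i) by
    refine ⟨h.1, h.2.1, fun i hi => ?_⟩
    have := h.2.2 i hi
    have h' := zigzagHeight_append (l.take i) (l.drop i)
    rw [List.take_append_drop] at h'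
    omega
  induction m generalizing s l with
  | zero =>
    cases s with
    | zero =>
      obtain rfl : l = [] := by simpa [endsHighestLists] using h
      exact ⟨rfl, rfl, by simp⟩
    | succ s => simp [endsHighestLists] at h
  | succ m ih =>
    cases s with
    | zero => simp [endsHighestLists] at h
    | succ s =>
      simp only [endsHighestLists, Finset.mem_union, Finset.mem_map,
        Function.Embedding.coeFn_mk] at h
      obtain ⟨l, hl, rfl⟩ | ⟨l, hl, rfl⟩ := h
      all_goals
        obtain ⟨h₁, h₂, h₃⟩ := ih hl
        refine ⟨by simp [h₁], by rw [zigzagHeight_cons, h₂]; grind, ?_⟩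
        rintro (- | i) hi
        · rw [List.drop_zero, zigzagHeight_cons, h₂]; grind
        · exact h₃ i (by simpa using hi)

theorem card_endsHighestLists_succ_succ (m s : ℕ) : (endsHighestLists (m + 1) (s + 1)).card =
    (endsHighestLists m s).card + (endsHighestLists m (s + 2)).card := by
  rw [endsHighestLists, Finset.card_union_of_disjoint, Finset.card_map, Finset.card_map]
  rw [Finset.disjoint_left]
  simp

/-- The number of walks of length `m` from `0` to `s` with steps `1` and `-1`. -/
def walkCount (m s : ℕ) : ℕ := if Even (m + s) then m.choose ((m + s) / 2) else 0

theorem walkCount_succ_succ (m s : ℕ) :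
    walkCount (m + 1) (s + 1) = walkCount m s + walkCount m (s + 2) := by
  unfold walkCount
  by_cases h : Even (m + s)
  · rw [if_pos h, if_pos (by grind), if_pos (by grind),
      show (m + 1 + (s + 1)) / 2 = (m + s) / 2 + 1 by omega,
      show (m + (s + 2)) / 2 = (m + s) / 2 + 1 by omega, Nat.choose_succ_succ]
  · rw [if_neg h, if_neg (by grind), if_neg (by grind)]

/-- A walk that ends at `0` comes from `1` or `-1`, which are symmetric. This is the boundary case
of the recursion. -/
theorem walkCount_succ_zero (m : ℕ) : walkCount (m + 1) 0 = 2 * walkCount m 1 := by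
  unfold walkCount
  by_cases h : Even (m + 1)
  · obtain ⟨k, hk⟩ := h
    obtain ⟨k, rfl⟩ : ∃ j, k = j + 1 := ⟨k - 1, by omega⟩
    obtain rfl : m = 2 * k + 1 := by omega
    rw [if_pos (by grind), if_pos (by grind), show (2 * k + 1 + 1 + 0) / 2 = k + 1 by omega, Nat.choose_succ_succ,
      Nat.choose_symm_half]
    ring
  · rw [if_neg (by simpa using h), if_neg h]

theorem walkCount_of_lt {m s : ℕ} (h : m < s) : walkCount m s = 0 := by
  unfold walkCount
  split_ifs with h'
  · rw [Nat.even_iff] at h'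
    exact Nat.choose_eq_zero_of_lt (by omega)
  · rfl

/-- The ballot numbers. -/
theorem card_endsHighestLists_add (m s : ℕ) :
    (endsHighestLists (m + 1) (s + 1)).card + walkCount m (s + 2) = walkCount m s := by
  induction m generalizing s with
  | zero =>
    rw [card_endsHighestLists_succ_succ]
    rcases s with - | s
    · simp [endsHighestLists, walkCount]
    · simp [endsHighestLists, walkCount_of_lt]
  | succ m ih =>
    rw [card_endsHighestLists_succ_succ]
    rcases s with - | s
    · have h₁ := ih 1
      have h₂ := walkCount_succ_succ m 1
      have h₃ := walkCount_succ_zero m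
      have h₄ : (endsHighestLists (m + 1) 0).card = 0 := rfl
      simp only [Nat.reduceAdd, Nat.zero_add] at *
      omega
    · have h₁ := ih s
      have h₂ := ih (s + 2)
      have h₃ := walkCount_succ_succ m s
      have h₄ := walkCount_succ_succ m (s + 2)
      simp only [Nat.add_assoc, Nat.reduceAdd] at *
      omega

/-- The ballot differences telescope. Of the initial terms `walkCount m 0` and `walkCount m 1`,
parity leaves one, the middle binomial coefficient. -/
theorem sum_card_endsHighestLists (m k : ℕ) :
    ∑ s ∈ Finset.range k, (endsHighestLists (m + 1) (s + 1)).card + (walkCount m k +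
      walkCount m (k + 1)) = m.choose (m / 2) := by
  induction k with
  | zero =>
    unfold walkCount
    rcases Nat.even_or_odd' m with ⟨j, rfl | rfl⟩
    · rw [if_pos (by simp), if_neg (by grind)]
      simp
    · rw [if_neg (by simp), if_pos (by grind), Finset.sum_range_zero, zero_add, zero_add,
        show (2 * j + 1 + (0 + 1)) / 2 = j + 1 by omega, show (2 * j + 1) / 2 = j by omega,
        Nat.choose_symm_half]
  | succ k ih =>
    rw [Finset.sum_range_succ]
    have := card_endsHighestLists_add m k
    simp only [Nat.add_assoc, Nat.reduceAdd] at *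
    omega

theorem exists_finset_endsHighest (n : ℕ) (hn : 1 ≤ n) : ∃ A : Finset (List Bool),
    A.card = (n - 1).choose ((n - 1) / 2) ∧ ∀ l ∈ A, l.length = n ∧ EndsHighest l := by
  obtain ⟨m, rfl⟩ : ∃ m, n = m + 1 := ⟨n - 1, by omega⟩
  refine ⟨(Finset.range (m + 1)).biUnion fun s => endsHighestLists (m + 1) (s + 1), ?_, ?_⟩
  · have h := sum_card_endsHighestLists m (m + 1)
    -- No walk of length `m` reaches `m + 1` or `m + 2`, so the tail of the telescoping sum
    -- vanishes.
    rw [walkCount_of_lt (by omega), walkCount_of_lt (by omega)] at h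
    rw [Finset.card_biUnion, ← Nat.add_sub_cancel m 1] at *
    · simpa using h
    · intro s _ t _ hst
      refine Finset.disjoint_left.2 fun l h₁ h₂ => hst ?_
      have h₁ := (mem_endsHighestLists h₁).2.1
      have h₂ := (mem_endsHighestLists h₂).2.1
      omega
  · intro l hl
    obtain ⟨s, -, hs⟩ := Finset.mem_biUnion.1 hl
    exact ⟨(mem_endsHighestLists hs).1, (mem_endsHighestLists hs).2.2⟩

namespace FAd

/-- A finite set of elements that contains those of all zigzag paths of length `n` that end at
their highest vertex is large. -/
theorem choose_le_ncard_of_zigzag_mem {n : ℕ} (hn : 1 ≤ n) {S : Set (FAd Unit)} (hS : S.Finite)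
    (h : ∀ l : List Bool, l.length = n → EndsHighest l → mk (zigzag l) ∈ S) :
    (n - 1).choose ((n - 1) / 2) ≤ S.ncard := by
  classical
  obtain ⟨A, hA, hA'⟩ := exists_finset_endsHighest n hn
  rw [← hA, ← Set.ncard_coe_finset]
  refine Set.ncard_le_ncard_of_injOn (fun l => mk (zigzag l))
    (fun l hl => h l (hA' l hl).1 (hA' l hl).2) ?_ hS
  intro l hl l' hl' heq
  exact eq_of_mk_zigzag_eq (hA' l hl).2 (hA' l' hl').2 ((hA' l hl).1.trans (hA' l' hl').1.symm) heq

end FAd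

/-! ### The exponential upper bound. -/

/-- Instructions of a stack machine that evaluates words in postfix notation. -/
inductive StackOp
  | letter | mul | plus | star | skip

instance : Fintype StackOp where
  elems := ⟨↑[StackOp.letter, .mul, .plus, .star, .skip], by simp⟩
  complete x := by cases x <;> exact Multiset.mem_coe.2 (by simp)

theorem StackOp.card : Nat.card StackOp = 5 := by
  rw [Nat.card_eq_fintype_card]; rfl

/-- The effect of an instruction on the stack. -/
def StackOp.step {M : Type*} [AdequateMonoid M] (a : M) : List M → StackOp → List M
  | st, letter => a :: st
  | y :: x :: st, mul => x * y :: st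
  | x :: st, plus => AdequateMonoid.plus x :: st
  | x :: st, star => AdequateMonoid.star x :: st
  | st, _ => st

/-- A program computes `m` if it pushes `m` on the stack. -/
def Computes {M : Type*} [AdequateMonoid M] (a : M) (l : List StackOp) (m : M) : Prop :=
  ∀ st, l.foldl (StackOp.step a) st = m :: st

section

variable {M : Type*} [AdequateMonoid M] {a : M}

open AdequateMonoid

theorem Computes.mul {l l' : List StackOp} {x y : M} (h : Computes a l x) (h' : Computes a l' y) :
    Computes a (l ++ l' ++ [.mul]) (x * y) := fun st => by
  rw [List.foldl_append, List.foldl_append, h, h']; rfl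

theorem Computes.plus {l : List StackOp} {x : M} (h : Computes a l x) :
    Computes a (l ++ [.plus]) (plus x) := fun st => by
  rw [List.foldl_append, h]; rfl

theorem Computes.star {l : List StackOp} {x : M} (h : Computes a l x) :
    Computes a (l ++ [.star]) (star x) := fun st => by
  rw [List.foldl_append, h]; rfl

theorem Computes.skip {l : List StackOp} {x : M} (h : Computes a l x) (k : ℕ) :
    Computes a (l ++ List.replicate k .skip) x := fun st => by
  rw [List.foldl_append, h]
  induction k with
  | zero => rfl
  | succ k ih => exact ih

theorem plus_eq_of_idem {x : M} (h : IsIdempotentElem x) : plus x = x :=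
  (eq_plus_of_idem x h).symm

theorem star_eq_of_idem {x : M} (h : IsIdempotentElem x) : star x = x :=
  (eq_star_of_idem x h).symm

/-- Values of words of length zero are trivial, and values of other words are computed by programs
of linear size, up to a final unary operation. -/
theorem exists_computes (w : BiWord Unit) : (w.length = 0 ∧ w.eval (fun _ => a) = 1) ∨
    (0 < w.length ∧ ∃ l x, l.length + 3 ≤ 4 * w.length ∧ Computes a l x ∧
      (w.eval (fun _ => a) = x ∨ w.eval (fun _ => a) = plus x ∨ w.eval (fun _ => a) = star x)) := by
  have hone : IsIdempotentElem (1 : M) := IsIdempotentElem.one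
  induction w with
  | one => exact Or.inl ⟨rfl, rfl⟩
  | of x => exact Or.inr ⟨Nat.one_pos, [.letter], a, le_rfl, fun st => rfl, Or.inl rfl⟩
  | mul s t hs ht =>
    -- Performing the pending unary operation costs one instruction, hence `2` in place of `3`. The
    -- slack `2 + 2` of the two factors, less one for the multiplication, is again `3`.
    have hfull {w : BiWord Unit} (h : ∃ l x, l.length + 3 ≤ 4 * w.length ∧ Computes a l x ∧
        (w.eval (fun _ => a) = x ∨ w.eval (fun _ => a) = plus x ∨ w.eval (fun _ => a) = star x)) :
        ∃ l, l.length + 2 ≤ 4 * w.length ∧ Computes a l (w.eval fun _ => a) := by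
      obtain ⟨l, x, hl, hx, h | h | h⟩ := h
      · exact ⟨l, by omega, h ▸ hx⟩
      · exact ⟨l ++ [.plus], by simp; omega, h ▸ hx.plus⟩
      · exact ⟨l ++ [.star], by simp; omega, h ▸ hx.star⟩
    obtain ⟨hs₀, hs⟩ | ⟨hs₀, hs⟩ := hs
    · simpa [BiWord.eval, BiWord.length, hs₀, hs] using ht
    · obtain ⟨ht₀, ht⟩ | ⟨ht₀, ht⟩ := ht
      · right
        simpa [BiWord.eval, BiWord.length, ht₀, ht, hs₀] using hs
      · obtain ⟨l, hl, hx⟩ := hfull hs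
        obtain ⟨k, hk, hy⟩ := hfull ht
        exact Or.inr ⟨by simp only [BiWord.length]; omega, _, _,
          by simp [BiWord.length]; omega, hx.mul hy, Or.inl rfl⟩
  | plus s hs =>
    obtain ⟨hs₀, hs⟩ | ⟨hs₀, l, x, hl, hx, hs⟩ := hs
    · exact Or.inl ⟨hs₀, by rw [BiWord.eval, hs, plus_eq_of_idem hone]⟩
    · refine Or.inr ⟨hs₀, l, x, hl, hx, ?_⟩
      rw [BiWord.eval]
      obtain h | h | h := hs <;> rw [h]
      · exact Or.inr (Or.inl rfl)
      · exact Or.inr (Or.inl (plus_eq_of_idem (FAd.isIdempotentElem_plus x)))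
      · exact Or.inr (Or.inr (plus_eq_of_idem (FAd.isIdempotentElem_star x)))
  | star s hs =>
    obtain ⟨hs₀, hs⟩ | ⟨hs₀, l, x, hl, hx, hs⟩ := hs
    · exact Or.inl ⟨hs₀, by rw [BiWord.eval, hs, star_eq_of_idem hone]⟩
    · refine Or.inr ⟨hs₀, l, x, hl, hx, ?_⟩
      rw [BiWord.eval]
      obtain h | h | h := hs <;> rw [h]
      · exact Or.inr (Or.inr rfl)
      · exact Or.inr (Or.inl (star_eq_of_idem (FAd.isIdempotentElem_plus x)))
      · exact Or.inr (Or.inr (star_eq_of_idem (FAd.isIdempotentElem_star x)))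

/-- The value of a program of length `4 * n`. -/
def programValue (a : M) (n : ℕ) (g : Fin (4 * n) → StackOp) : M :=
  (((List.ofFn g).foldl (StackOp.step a) []).head?).getD 1

theorem eval_mem_range_programValue (w : BiWord Unit) :
    w.eval (fun _ => a) ∈ Set.range (programValue a w.length) := by
  obtain ⟨h₀, h⟩ | ⟨-, l, x, hl, hx, h⟩ := exists_computes (a := a) w
  -- At length zero the program is empty, and the default value `1` of `programValue` is the value
  -- of the word.
  · refine ⟨fun _ => .skip, ?_⟩
    rw [h, h₀]
    rfl
  · obtain ⟨k, hk, hk'⟩ : ∃ k : List StackOp, k.length = 4 * w.length ∧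
        Computes a k (w.eval fun _ => a) := by
      obtain h | h | h := h
      · exact ⟨_, by simp; omega, h ▸ hx.skip (4 * w.length - l.length)⟩
      · exact ⟨_, by simp; omega, h ▸ hx.plus.skip (4 * w.length - l.length - 1)⟩
      · exact ⟨_, by simp; omega, h ▸ hx.star.skip (4 * w.length - l.length - 1)⟩
    refine ⟨fun i => k[i], ?_⟩
    have hofFn : List.ofFn (fun i : Fin (4 * w.length) => k[i]) = k := by
      apply List.ext_getElem <;> simp [hk]
    rw [programValue, hofFn, hk' []]
    rfl

end

namespace FAd

theorem eval_of (w : BiWord Unit) : w.eval (fun _ => of ()) = mk w := by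
  induction w with
  | one => rfl
  | of x => rfl
  | mul s t hs ht => rw [BiWord.eval, hs, ht]; rfl
  | plus s hs => rw [BiWord.eval, hs]; rfl
  | star s hs => rw [BiWord.eval, hs]; rfl

/-- The elements represented by words of length `n` lie in a finite set of exponential size. -/
theorem finite_and_ncard_le {n : ℕ} {S : Set (FAd Unit)}
    (h : ∀ m ∈ S, ∃ w : BiWord Unit, w.length = n ∧ mk w = m) : S.Finite ∧ S.ncard ≤ 625 ^ n := by
  have hS : S ⊆ Set.range (programValue (of ()) n) := by
    intro m hm
    obtain ⟨w, rfl, rfl⟩ := h m hm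
    rw [← eval_of]
    exact eval_mem_range_programValue w
  refine ⟨(Set.finite_range _).subset hS, (Set.ncard_le_ncard hS (Set.finite_range _)).trans ?_⟩
  rw [← Set.image_univ]
  refine (Set.ncard_image_le (Set.finite_univ)).trans ?_
  -- There are `5 ^ (4 * n) = 625 ^ n` programs.
  rw [Set.ncard_univ, Nat.card_fun, StackOp.card, Nat.card_fin, pow_mul]
  norm_num

theorem exists_word_of_mem_idempotentSphere {n : ℕ} {m : FAd Unit}
    (hm : m ∈ idempotentSphere Unit n) : ∃ w : BiWord Unit, w.length = n ∧ mk w = m := by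
  obtain ⟨⟨⟨w, hw, h⟩, hmin⟩, -⟩ := hm
  refine ⟨w, hw.antisymm (not_lt.1 fun hlt => hmin _ hlt ⟨w, le_rfl, h⟩), h⟩

theorem exists_word_of_hasEdges {n : ℕ} {m : FAd Unit} (hm : m.HasEdges n) :
    ∃ w : BiWord Unit, w.length = n ∧ mk w = m := by
  obtain ⟨w, h, -, hw⟩ := hm
  exact ⟨w, (XGraph.card_ofWord_E w).symm.trans hw, h⟩

end FAd

/-! ### Asymptotics of the middle binomial coefficients and the growth rate. -/

open Real in
/-- **Wallis' formula** for central binomial coefficients. -/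
theorem tendsto_centralBinom_sq :
    Tendsto (fun k : ℕ => (k.centralBinom : ℝ) ^ 2 / 16 ^ k * (2 * k + 1)) atTop (𝓝 (2 / π)) := by
  have h := Wallis.tendsto_W_nhds_pi_div_two.inv₀ (by positivity)
  rw [inv_div] at h
  refine h.congr fun k => ?_
  have hk : ((2 * k).factorial : ℝ) = k.centralBinom * k.factorial ^ 2 := by
    have := Nat.choose_mul_factorial_mul_factorial (show k ≤ 2 * k by omega)
    rw [← Nat.centralBinom_eq_two_mul_choose, show 2 * k - k = k by omega] at this
    rw [← this]; push_cast; ring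
  have h₁ : (k.factorial : ℝ) ≠ 0 := by positivity
  have h₂ : (k.centralBinom : ℝ) ≠ 0 := by exact_mod_cast k.centralBinom_ne_zero
  rw [Wallis.W_eq_factorial_ratio, hk, show (2 : ℝ) ^ (4 * k) = 16 ^ k by rw [pow_mul]; norm_num]
  field_simp

/-- For odd `m`, the next central binomial coefficient is twice the middle one of row `m`, and the
powers of two compensate. Both parities thus reduce to Wallis' formula. -/
theorem choose_half_sq_div (m : ℕ) : ((m.choose (m / 2) : ℕ) : ℝ) ^ 2 / 4 ^ m =
    (((m + 1) / 2).centralBinom : ℝ) ^ 2 / 16 ^ ((m + 1) / 2) := by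
  rcases Nat.even_or_odd' m with ⟨j, rfl | rfl⟩
  · rw [show (2 * j + 1) / 2 = j by omega, show 2 * j / 2 = j by omega,
      ← Nat.centralBinom_eq_two_mul_choose, pow_mul]
    norm_num
  · have h : (j + 1).centralBinom = 2 * (2 * j + 1).choose j := by
      rw [Nat.centralBinom_eq_two_mul_choose, show 2 * (j + 1) = 2 * j + 1 + 1 by ring,
        Nat.choose_succ_succ, Nat.choose_symm_half]
      ring
    rw [show (2 * j + 1 + 1) / 2 = j + 1 by omega, show (2 * j + 1) / 2 = j by omega, h,
      show (4 : ℝ) ^ (2 * j + 1) = 16 ^ j * 4 by rw [pow_succ, pow_mul]; norm_num, pow_succ 16]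
    push_cast
    field_simp
    ring

open Real in
theorem tendsto_choose_half_sq : Tendsto
    (fun m : ℕ => ((m.choose (m / 2) : ℕ) : ℝ) ^ 2 / 4 ^ m * m) atTop (𝓝 (2 / π)) := by
  have hk : Tendsto (fun m : ℕ => (m + 1) / 2) atTop atTop :=
    tendsto_atTop.2 fun b => eventually_atTop.2 ⟨2 * b, fun m hm => by omega⟩
  have hq : Tendsto (fun m : ℕ => (m : ℝ) / (2 * ((m + 1) / 2 : ℕ) + 1)) atTop (𝓝 1) := by
    refine tendsto_of_tendsto_of_tendsto_of_le_of_le (tendsto_natCast_div_add_atTop (2 : ℝ))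
      tendsto_const_nhds (fun m => ?_) fun m => ?_
    · have h : (2 * ((m + 1) / 2 : ℕ) + 1 : ℝ) ≤ m + 2 := by
        exact_mod_cast (by omega : 2 * ((m + 1) / 2) + 1 ≤ m + 2)
      exact div_le_div_of_nonneg_left (by positivity) (by positivity) h
    · refine div_le_one_of_le₀ ?_ (by positivity)
      have h : m ≤ 2 * ((m + 1) / 2) + 1 := by omega
      have h' : (m : ℝ) ≤ (2 * ((m + 1) / 2) + 1 : ℕ) := Nat.cast_le.2 h
      simpa using h'
  have h := (tendsto_centralBinom_sq.comp hk).mul hq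
  rw [mul_one] at h
  refine h.congr fun m => ?_
  rw [choose_half_sq_div, Function.comp_apply]
  field_simp

/-- The asymptotics of the middle binomial coefficients. -/
theorem choose_half_isEquivalent : (fun m : ℕ => ((m.choose (m / 2) : ℕ) : ℝ)) ~[atTop]
    fun m : ℕ => 2 ^ m * √(2 / (m * Real.pi)) := by
  refine isEquivalent_of_tendsto_one ?_
  have h := (tendsto_choose_half_sq.mul_const (Real.pi / 2)).sqrt
  rw [div_mul_div_cancel₀ Real.pi_ne_zero, div_self two_ne_zero, Real.sqrt_one] at h
  refine h.congr' ?_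
  filter_upwards [eventually_gt_atTop 0] with m hm
  have hm' : (0 : ℝ) < m := by exact_mod_cast hm
  rw [Pi.div_apply, Real.sqrt_eq_iff_eq_sq (by positivity) (by positivity), div_pow, mul_pow,
    Real.sq_sqrt (by positivity), ← pow_mul, mul_comm m 2, pow_mul]
  norm_num
  field_simp

theorem two_pow_le_mul_choose_half (m : ℕ) : 2 ^ m ≤ (m + 1) * m.choose (m / 2) := by
  rw [← Nat.sum_range_choose]
  refine (Finset.sum_le_card_nsmul _ _ _ fun r _ => Nat.choose_le_middle r m).trans ?_
  simp

theorem two_le_liminf_rpow {u : ℕ → ℕ} (hu : ∀ n, 1 ≤ n → (n - 1).choose ((n - 1) / 2) ≤ u n) :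
    2 ≤ liminf (fun n : ℕ => (u n : ℝ≥0∞) ^ (1 / (n : ℝ))) atTop := by
  -- This is the `n`-th root of the bound `2 ^ n / (2 * n)`. The exponent `1 / n` takes the shape
  -- required by `tendsto_rpow_div_mul_add` at the argument `2 * n`.
  have h₁ : Tendsto (fun n : ℕ => 2 / ((2 * n : ℕ) : ℝ) ^ (2 / (1 * ((2 * n : ℕ) : ℝ) + 0))) atTop
      (𝓝 2) := by
    have h := (tendsto_rpow_div_mul_add 2 1 0 one_ne_zero.symm).comp
      ((tendsto_natCast_atTop_atTop (R := ℝ)).comp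
        (tendsto_id.const_mul_atTop' (show 0 < 2 by norm_num)))
    have h' := (tendsto_const_nhds (x := (2 : ℝ))).div h one_ne_zero
    rw [div_one] at h'
    exact h'
  have h₂ := (ENNReal.tendsto_ofReal h₁).liminf_eq
  rw [ENNReal.ofReal_ofNat] at h₂
  rw [← h₂]
  refine liminf_le_liminf ?_
  filter_upwards [eventually_ge_atTop 1] with n hn
  have hn' : (0 : ℝ) < n := by exact_mod_cast hn
  have hle : (2 : ℝ) ^ n / (2 * n : ℕ) ≤ u n := by
    rw [div_le_iff₀ (by positivity)]
    have h := two_pow_le_mul_choose_half (n - 1)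
    rw [Nat.sub_add_cancel hn] at h
    have h' : 2 ^ n ≤ u n * (2 * n) := by
      calc 2 ^ n = 2 * 2 ^ (n - 1) := by rw [← pow_succ', Nat.sub_add_cancel hn]
        _ ≤ 2 * (n * (n - 1).choose ((n - 1) / 2)) := by gcongr
        _ ≤ 2 * (n * u n) := by gcongr; exact hu n hn
        _ = u n * (2 * n) := by ring
    exact_mod_cast h'
  calc ENNReal.ofReal (2 / ((2 * n : ℕ) : ℝ) ^ (2 / (1 * ((2 * n : ℕ) : ℝ) + 0)))
      = ENNReal.ofReal (((2 : ℝ) ^ n / (2 * n : ℕ)) ^ (1 / (n : ℝ))) := by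
        rw [Real.div_rpow (by positivity) (by positivity), ← Real.rpow_natCast,
          ← Real.rpow_mul (by positivity), mul_one_div_cancel hn'.ne', Real.rpow_one,
          show 2 / (1 * ((2 * n : ℕ) : ℝ) + 0) = 1 / n by push_cast; field_simp; ring]
    _ = ENNReal.ofReal ((2 : ℝ) ^ n / (2 * n : ℕ)) ^ (1 / (n : ℝ)) :=
        (ENNReal.ofReal_rpow_of_nonneg (by positivity) (by positivity)).symm
    _ ≤ (u n : ℝ≥0∞) ^ (1 / (n : ℝ)) := by
        gcongr
        exact (ENNReal.ofReal_le_ofReal hle).trans_eq (ENNReal.ofReal_natCast _)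

theorem limsup_rpow_lt_top {u : ℕ → ℕ} {c : ℕ} (hu : ∀ n, u n ≤ c ^ n) :
    limsup (fun n : ℕ => (u n : ℝ≥0∞) ^ (1 / (n : ℝ))) atTop < ⊤ := by
  refine lt_of_le_of_lt (limsup_le_of_le (h := ?_)) (ENNReal.natCast_lt_top c)
  filter_upwards [eventually_ge_atTop 1] with n hn
  have hn' : (n : ℝ) ≠ 0 := by exact_mod_cast (by omega : n ≠ 0)
  calc (u n : ℝ≥0∞) ^ (1 / (n : ℝ)) ≤ ((c : ℝ≥0∞) ^ n) ^ (1 / (n : ℝ)) := by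
        gcongr
        exact_mod_cast hu n
    _ = c := by
        rw [← ENNReal.rpow_natCast, ← ENNReal.rpow_mul, mul_one_div_cancel hn', ENNReal.rpow_one]

theorem mainTheorem5 :
    -- the spheres of idempotents are finite, so that their sizes are meaningful
    (∀ n : ℕ, (FAd.idempotentSphere Unit n).Finite) ∧
    -- the lower bound, for idempotents in the sphere and for idempotents with `n` edges
    (∀ n : ℕ, 1 ≤ n →
      (n - 1).choose ((n - 1) / 2) ≤ (FAd.idempotentSphere Unit n).ncard) ∧
    (∀ n : ℕ, 1 ≤ n →
      {m : FAd Unit | IsIdempotentElem m ∧ m.HasEdges n}.Finite ∧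
      (n - 1).choose ((n - 1) / 2) ≤
        {m : FAd Unit | IsIdempotentElem m ∧ m.HasEdges n}.ncard) ∧
    -- the asymptotics of the bound
    (fun n : ℕ => (((n - 1).choose ((n - 1) / 2) : ℕ) : ℝ)) ~[atTop]
      (fun n : ℕ => 2 ^ (n - 1) * Real.sqrt (2 / (((n - 1 : ℕ) : ℝ) * Real.pi))) ∧
    -- the idempotent growth is exponential, of degree at least 2
    2 ≤ liminf (fun n : ℕ =>
      (((FAd.idempotentSphere Unit n).ncard : ℕ) : ℝ≥0∞) ^ (1 / (n : ℝ))) atTop ∧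
    limsup (fun n : ℕ =>
      (((FAd.idempotentSphere Unit n).ncard : ℕ) : ℝ≥0∞) ^ (1 / (n : ℝ))) atTop < ⊤ := by
  have hfin (n : ℕ) := FAd.finite_and_ncard_le (n := n) (S := FAd.idempotentSphere Unit n)
    fun _ => FAd.exists_word_of_mem_idempotentSphere
  have hlower (n : ℕ) (hn : 1 ≤ n) :
      (n - 1).choose ((n - 1) / 2) ≤ (FAd.idempotentSphere Unit n).ncard :=
    FAd.choose_le_ncard_of_zigzag_mem hn (hfin n).1 fun l hl h =>
      hl ▸ FAd.zigzag_mem_idempotentSphere h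
  refine ⟨fun n => (hfin n).1, hlower, fun n hn => ?_, ?_, two_le_liminf_rpow hlower,
    limsup_rpow_lt_top fun n => (hfin n).2⟩
  · have hfin' := (FAd.finite_and_ncard_le (n := n) (S := {m | IsIdempotentElem m ∧ m.HasEdges n})
      fun _ hm => FAd.exists_word_of_hasEdges hm.2).1
    exact ⟨hfin', FAd.choose_le_ncard_of_zigzag_mem hn hfin' fun l hl h =>
      ⟨FAd.isIdempotentElem_zigzag l, hl ▸ FAd.hasEdges_zigzag h⟩⟩
  · exact choose_half_isEquivalent.comp_tendsto (tendsto_sub_atTop_nat 1)
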